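/- For $d\ge 0$ let $T_d\in\mathbb{Z}[x]$ be the monic Chebyshev polynomial, defined by $T_0=2$, $T_1=x$, $T_{d+2}=xT_{d+1}-T_d$ (so that $T_d(z+z^{-1})=z^d+z^{-d}$). Let $\ell$ be an odd prime and $t$ an integer. For $n\ge 1$ let $T_\ell^n$ be the $n$-fold iterate of $T_\ell$ under composition and $\Phi_n(x)=T_\ell^n(x)-t$. Suppose that $\Phi_n$ is irreducible, let $\theta_n$ be a root of $\Phi_n$ and $K_n=\mathbb{Q}(\theta_n)$, with ring of integers $\mathcal{O}_{K_n}$. Write $D(\Phi_n)$ for the discriminant of the polynomial $\Phi_n$ and $\Delta(K_n)$ for the discriminant of the number field $K_n$. Then $D(\Phi_n)=\Delta(K_n)$ if and only if both of the following hold: 1. $T_\ell(t)\not\equiv t \pmod{\ell^2}$; 2. $t-2$ and $t+2$ are both square-free. Moreover, $D(\Phi_n)=\Delta(K_n)$ if and only if $\mathbb{Z}[\theta_n]=\mathcal{O}_{K_n}$, and in that case $K_n$ is monogenic, that is, $\mathcal{O}_{K_n}$ has a power basis over $\mathbb{Z}$. In particular, whether $\mathcal{O}_{K_n}=\mathbb{Z}[\theta_n]$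 holds does not depend on $n$: if $m,n\ge 1$ and $\Phi_m$ and $\Phi_n$ are both irreducible, then $\mathcal{O}_{K_m}=\mathbb{Z}[\theta_m]$ if and only if $\mathcal{O}_{K_n}=\mathbb{Z}[\theta_n]$, for any roots $\theta_m$ of $\Phi_m$ and $\theta_n$ of $\Phi_n$. -/

import Mathlib

open Polynomial NumberField

/-- The monic Chebyshev polynomial of the first kind `T_d ∈ ℤ[x]`, normalized by
`T_d(z + z⁻¹) = z ^ d + z ^ (-d)`. In Mathlib this is the rescaled Chebyshev polynomial
`Polynomial.Chebyshev.C`: `T_0 = 2`, `T_1 = x`, `T_{d+2} = x T_{d+1} - T_d`. -/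
noncomputable def chebT (d : ℕ) : ℤ[X] := Chebyshev.C ℤ (d : ℤ)

/-- The `n`-fold iterate of a polynomial under composition:
`f^0 = x` and `f^{n+1} = f ∘ f^n`. -/
noncomputable def polyIter (f : ℤ[X]) : ℕ → ℤ[X]
  | 0 => X
  | n + 1 => f.comp (polyIter f n)

/-- `Φ(x) = T_ℓ^n(x) - t`, where `T_ℓ^n` is the `n`-fold iterate of `T_ℓ`. -/
noncomputable def chebPhi (ℓ n : ℕ) (t : ℤ) : ℤ[X] := polyIter (chebT ℓ) n - C t

/-- `K = ℚ(θ)` where `θ` is a root of `f`. -/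
structure IsGeneratedByRoot (f : ℤ[X]) (K : Type*) [Field K] [NumberField K] (θ : K) : Prop where
  root : aeval θ f = 0
  gen : IntermediateField.adjoin ℚ {θ} = ⊤

/-- `ℤ[θ] = 𝓞_K`, as subrings of `K`. -/
def IsMaximalOrderGenerator (K : Type*) [Field K] [NumberField K] (θ : K) : Prop :=
  Algebra.adjoin ℤ {θ} = integralClosure ℤ K

/-- `K` is monogenic: its ring of integers has a power basis over `ℤ`. -/
def IsMonogenicField (K : Type*) [Field K] [NumberField K] : Prop :=
  Nonempty (PowerBasis ℤ (𝓞 K))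

/-!
The iterate `T_ℓ ^ n` is the Chebyshev polynomial `C_d` with `d = ℓ ^ n`, so `Φ_n = C_d - t`. The
discriminants of `Φ_n` and `K_n` differ by the square of the index of `ℤ[θ]` in the ring of
integers (`discr_eq_iff`), and the question is when `ℤ[θ]` is integrally closed. By Dedekind's
criterion this holds exactly when `Φ_n ∉ 𝔪 ^ 2` for all maximal ideals `𝔪 = (p, π)` of `ℤ[X]`
(`isIntegrallyClosed_of_notMem_sq` and `not_adjoin_eq_integralClosure`).

For odd `d = 2 m + 1` put `g = S_m + S_{m-1}` and `h = S_m - S_{m-1}`. Then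
`C_d - 2 = (X - 2) g ^ 2`, `C_d + 2 = (X + 2) h ^ 2` and `(C_d') ^ 2 = d ^ 2 (g h) ^ 2`. If
`Φ_n ∈ 𝔪 ^ 2` then `Φ_n' ∈ 𝔪`, so `𝔪` contains `g`, `h` or `ℓ`. In the first case
`Φ_n = (X - 2) g ^ 2 - (t - 2)` shows `t - 2 ∈ 𝔪 ^ 2`, which happens for no square-free `t - 2`;
conversely `p ^ 2 ∣ t - 2` puts `Φ_n` in `(p, g) ^ 2`. The second case is the same with `t + 2` and
`h`. In the last case `Φ_n ≡ (X - t) ^ d` modulo `ℓ`, so `𝔪 = (ℓ, X - t)` and `Φ_n ∈ 𝔪 ^ 2` means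
`ℓ ^ 2 ∣ Φ_n(t)`; finally `C_{ℓ ^ n}(t) ≡ C_ℓ(t)` modulo `ℓ ^ 2`
(`ChebyshevC.sq_dvd_eval_sub_eval`), which removes `n` from the condition.
-/

/-! ### Divisibility by a prime in `ℤ[X]` -/

lemma natCast_dvd_of_map_zmod_eq_zero {p : ℕ} {q : ℤ[X]}
    (hq : q.map (Int.castRingHom (ZMod p)) = 0) : (p : ℤ[X]) ∣ q := by
  have h : C (p : ℤ) ∣ q := by
    rw [C_dvd_iff_dvd_coeff]
    intro i
    have := congrArg (coeff · i) hq
    rw [coeff_map, coeff_zero, eq_intCast] at this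
    exact (ZMod.intCast_zmod_eq_zero_iff_dvd _ _).mp this
  simpa using h

/-! ### Chebyshev polynomials -/

namespace ChebyshevC

open Chebyshev

/-- With `X = z + z⁻¹`, both sides are `z ^ (-2 m - 1) * (z ^ (2 m + 1) - 1) ^ 2`; here the identity
follows from the relation `a ^ 2 + b ^ 2 - X a b = 1` between consecutive `S` polynomials. -/
lemma sub_two_eq (R : Type*) [CommRing R] (m : ℕ) :
    C R (2 * m + 1) - 2 = (X - 2) * (S R m + S R (m - 1)) ^ 2 := by
  have h := S_sq_add_S_sq R ((m : ℤ) - 1)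
  have h1 := C_mul_C R ((m : ℤ) + 1) m
  have h2 := C_eq_S_sub_X_mul_S R m
  have h3 := C_eq_S_sub_X_mul_S R ((m : ℤ) + 1)
  have h4 := S_add_one R m
  rw [show (m : ℤ) + 1 + m = 2 * m + 1 by ring, show (m : ℤ) + 1 - m = 1 by ring, C_one] at h1
  rw [sub_add_cancel] at h
  rw [add_sub_cancel_right, h4] at h3
  rw [h2, h3] at h1
  linear_combination -h1 + (X + 2) * h

lemma add_two_eq (R : Type*) [CommRing R] (m : ℕ) :
    C R (2 * m + 1) + 2 = (X + 2) * (S R m - S R (m - 1)) ^ 2 := by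
  have h := S_sq_add_S_sq R ((m : ℤ) - 1)
  have h1 := C_mul_C R ((m : ℤ) + 1) m
  have h2 := C_eq_S_sub_X_mul_S R m
  have h3 := C_eq_S_sub_X_mul_S R ((m : ℤ) + 1)
  have h4 := S_add_one R m
  rw [show (m : ℤ) + 1 + m = 2 * m + 1 by ring, show (m : ℤ) + 1 - m = 1 by ring, C_one] at h1
  rw [sub_add_cancel] at h
  rw [add_sub_cancel_right, h4] at h3
  rw [h2, h3] at h1
  linear_combination -h1 + (X - 2) * h

lemma derivative_eq (R : Type*) [CommRing R] (n : ℕ) :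
    derivative (C R n) = n * S R (n - 1) := by
  induction n using Nat.twoStepInduction with
  | zero => simp
  | one => simp
  | more n ih1 ih2 =>
    push_cast at ih2 ⊢
    have h1 := C_add_two R n
    have h2 := C_eq_S_sub_X_mul_S R ((n : ℤ) + 1)
    have h3 := S_add_one R n
    rw [show (n : ℤ) + 2 - 1 = n + 1 by ring]
    rw [add_sub_cancel_right] at h2 ih2
    rw [h1, derivative_sub, derivative_mul, ih1, ih2, derivative_X]
    linear_combination h2 - n * h3

lemma sq_sub_four_eq (R : Type*) [CommRing R] (n : ℤ) :
    C R (n + 1) ^ 2 - 4 = (X ^ 2 - 4) * S R n ^ 2 := by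
  have h := S_sq_add_S_sq R n
  have h3 := C_eq_S_sub_X_mul_S R (n + 1)
  rw [add_sub_cancel_right] at h3
  rw [h3]
  linear_combination 4 * h

/-- The factor `S_{2m}` of the derivative of `C_{2m+1}` is, up to sign, the product of the
polynomials squared in `sub_two_eq` and `add_two_eq`. -/
lemma S_two_mul_sq (m : ℕ) :
    S ℤ (2 * m) ^ 2 = ((S ℤ m + S ℤ (m - 1)) * (S ℤ m - S ℤ (m - 1))) ^ 2 := by
  have h0 : (X ^ 2 - 4 : ℤ[X]) ≠ 0 := by
    intro h
    have := congrArg (eval 0) h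
    norm_num at this
  apply mul_left_cancel₀ h0
  linear_combination -sq_sub_four_eq ℤ (2 * m) + (C ℤ (2 * m + 1) + 2) * sub_two_eq ℤ m +
    (X - 2) * (S ℤ m + S ℤ (m - 1)) ^ 2 * add_two_eq ℤ m

lemma monic_and_natDegree (R : Type*) [CommRing R] [Nontrivial R] (n : ℕ) :
    (C R (n + 1)).Monic ∧ (C R (n + 1)).natDegree = n + 1 := by
  induction n using Nat.strong_induction_on with
  | _ n ih =>
    match n with
    | 0 => simp [monic_X]
    | 1 =>
      have : C R ((1 : ℕ) + 1) = X ^ 2 - Polynomial.C 2 := by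
        rw [map_ofNat]
        exact C_two R
      rw [this]
      exact ⟨monic_X_pow_sub_C _ two_ne_zero, natDegree_X_pow_sub_C⟩
    | n + 2 =>
      obtain ⟨h1, h2⟩ := ih n (by omega)
      obtain ⟨h3, h4⟩ := ih (n + 1) (by omega)
      have h := C_add_two R (n + 1)
      rw [show ((n + 2 : ℕ) : ℤ) + 1 = n + 1 + 2 by push_cast; ring, h]
      rw [show (n : ℤ) + 1 + 1 = (n + 1 : ℕ) + 1 by push_cast; ring]
      have hX : (X * C R ((n + 1 : ℕ) + 1)).natDegree = n + 3 := by
        rw [monic_X.natDegree_mul h3, h4, natDegree_X]; ring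
      have hlt : (C R (n + 1)).natDegree < (X * C R ((n + 1 : ℕ) + 1)).natDegree := by
        rw [hX, h2]; omega
      exact ⟨(monic_X.mul h3).sub_of_left (degree_lt_degree hlt),
        (natDegree_sub_eq_left_of_natDegree_lt hlt).trans hX⟩

lemma monic (R : Type*) [CommRing R] [Nontrivial R] {n : ℕ} (hn : 0 < n) : (C R n).Monic := by
  obtain ⟨k, rfl⟩ := Nat.exists_eq_succ_of_ne_zero hn.ne'
  simpa using (monic_and_natDegree R k).1

lemma natDegree (R : Type*) [CommRing R] [Nontrivial R] (n : ℕ) : (C R n).natDegree = n := by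
  rcases n with _ | k
  · simp
  · simpa using (monic_and_natDegree R k).2

lemma zmod_pow (ℓ : ℕ) [Fact ℓ.Prime] (n : ℕ) : C (ZMod ℓ) ((ℓ : ℤ) ^ n) = X ^ ℓ ^ n := by
  induction n with
  | zero => simp
  | succ n ih =>
    have h : C (ZMod ℓ) ℓ = X ^ ℓ := by
      rw [← dickson_one_one_eq_chebyshev_C, dickson_one_one_zmod_p]
    rw [pow_succ', C_mul, ih, h, X_pow_comp, ← pow_mul, ← pow_succ]

lemma exists_eq_X_pow_add (ℓ : ℕ) [Fact ℓ.Prime] (n : ℕ) :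
    ∃ H : ℤ[X], C ℤ ((ℓ : ℤ) ^ n) = X ^ ℓ ^ n + (ℓ : ℤ[X]) * H := by
  have h : (ℓ : ℤ[X]) ∣ C ℤ ((ℓ : ℤ) ^ n) - X ^ ℓ ^ n := by
    apply natCast_dvd_of_map_zmod_eq_zero
    rw [Polynomial.map_sub, Chebyshev.map_C, zmod_pow]
    simp
  obtain ⟨H, hH⟩ := h
  exact ⟨H, by rw [← hH]; ring⟩

lemma natCast_dvd_X_sub_C_pow_sub (ℓ : ℕ) [Fact ℓ.Prime] (n : ℕ) (t : ℤ) :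
    (ℓ : ℤ[X]) ∣ (X - Polynomial.C t) ^ ℓ ^ n - (C ℤ ((ℓ : ℤ) ^ n) - Polynomial.C t) := by
  apply natCast_dvd_of_map_zmod_eq_zero
  simp only [Polynomial.map_sub, Polynomial.map_pow, map_X, Polynomial.map_C, Chebyshev.map_C,
    zmod_pow, sub_pow_char_pow]
  rw [← Polynomial.C_pow, ZMod.pow_card_pow, sub_self]

lemma dvd_eval_sub (ℓ : ℕ) [Fact ℓ.Prime] (n : ℕ) (t : ℤ) :
    (ℓ : ℤ) ∣ (C ℤ ((ℓ : ℤ) ^ n)).eval t - t := by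
  obtain ⟨H, hH⟩ := exists_eq_X_pow_add ℓ n
  rw [hH, ← ZMod.intCast_zmod_eq_zero_iff_dvd]
  simp

/-- The class of `C_{ℓ ^ n}(t)` modulo `ℓ ^ 2` is the same for all `n ≥ 1`: as `C_ℓ` is congruent
to `X ^ ℓ` modulo `ℓ`, the class of `C_ℓ(y)` modulo `ℓ ^ 2` depends only on `y` modulo `ℓ`. -/
lemma sq_dvd_eval_sub_eval (ℓ : ℕ) [Fact ℓ.Prime] (n : ℕ) (t : ℤ) :
    (ℓ : ℤ) ^ 2 ∣ (C ℤ ((ℓ : ℤ) ^ (n + 1))).eval t - (C ℤ (ℓ : ℤ)).eval t := by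
  obtain ⟨H, hH⟩ := exists_eq_X_pow_add ℓ 1
  rw [pow_one, pow_one] at hH
  rw [pow_succ' (ℓ : ℤ) n, C_mul, eval_comp]
  have hy := dvd_eval_sub ℓ n t
  set y := (C ℤ ((ℓ : ℤ) ^ n)).eval t
  have h1 : (ℓ : ℤ) ^ 2 ∣ y ^ ℓ - t ^ ℓ := by
    simpa using dvd_sub_pow_of_dvd_sub hy 1
  have h2 : (ℓ : ℤ) ^ 2 ∣ ℓ * (H.eval y - H.eval t) := by
    rw [sq]
    exact mul_dvd_mul_left _ (hy.trans (sub_dvd_eval_sub y t H))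
  rw [hH]
  refine (dvd_add h1 h2).trans (dvd_of_eq ?_)
  simp only [eval_add, eval_pow, eval_X, eval_mul, eval_natCast]
  ring

end ChebyshevC

lemma polyIter_chebT (ℓ n : ℕ) : polyIter (chebT ℓ) n = Chebyshev.C ℤ ((ℓ : ℤ) ^ n) := by
  induction n with
  | zero => simp [polyIter]
  | succ n ih => rw [polyIter, ih, chebT, pow_succ', Chebyshev.C_mul]

lemma monic_chebPhi {ℓ : ℕ} (hℓ : ℓ.Prime) (n : ℕ) (t : ℤ) : (chebPhi ℓ n t).Monic := by
  have hpos : 0 < ℓ ^ n := pow_pos hℓ.pos n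
  rw [chebPhi, polyIter_chebT, ← Nat.cast_pow]
  refine (ChebyshevC.monic ℤ hpos).sub_of_left (lt_of_le_of_lt degree_C_le ?_)
  rwa [← natDegree_pos_iff_degree_pos, ChebyshevC.natDegree]

/-! ### Dedekind's criterion -/

/-- Half of Dedekind's criterion: if `f` lies in `(p, π) ^ 2` for some `π` that is not a unit
modulo `p`, then `(p B + π D)(θ) / p` is integral but does not lie in `ℤ[θ]`. -/
lemma not_adjoin_eq_integralClosure {K : Type*} [Field K] [CharZero K] {θ : K} {f : ℤ[X]}
    (hmonic : f.Monic) (hroot : aeval θ f = 0) (hdvd : ∀ q : ℤ[X], aeval θ q = 0 → f ∣ q)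
    {p : ℕ} (hp : p.Prime) {π A B D : ℤ[X]}
    (hπ : ¬ IsUnit (π.map (Int.castRingHom (ZMod p))))
    (hf : f = (p : ℤ[X]) ^ 2 * A + p * π * B + π ^ 2 * D) :
    Algebra.adjoin ℤ {θ} ≠ integralClosure ℤ K := by
  intro hmax
  have : Fact p.Prime := ⟨hp⟩
  have hpK : (p : K) ≠ 0 := by exact_mod_cast hp.ne_zero
  set z : K := aeval θ ((p : ℤ[X]) * B + π * D) with hz
  have hrel : (p : K) ^ 2 * aeval θ A + aeval θ π * z = 0 := by
    rw [← hroot, hf, hz]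
    simp only [map_add, map_mul, map_pow, map_natCast]
    ring
  have hθ : IsIntegral ℤ θ := ⟨f, hmonic, by simpa [aeval_def] using hroot⟩
  have hint (q : ℤ[X]) : aeval θ q ∈ integralClosure ℤ K :=
    (adjoin_le_integralClosure hθ) (aeval_mem_adjoin_singleton ℤ θ)
  have hy : z / p ∈ integralClosure ℤ K := by
    -- `y = z / p` is a root of the monic polynomial `Y ^ 2 - B(θ) Y + A(θ) D(θ)`.
    have hy' : IsIntegral (integralClosure ℤ K) (z / p) := by
      refine ⟨X ^ 2 - C ⟨_, hint B⟩ * X + C ⟨_, hint (A * D)⟩, by monicity!, ?_⟩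
      simp only [eval₂_add, eval₂_sub, eval₂_mul, eval₂_pow, eval₂_X, eval₂_C]
      change (z / p) ^ 2 - aeval θ B * (z / p) + aeval θ (A * D) = 0
      have hz' : z = p * aeval θ B + aeval θ π * aeval θ D := by
        rw [hz]; simp only [map_add, map_mul, map_natCast]
      rw [map_mul]
      field_simp
      linear_combination z * hz' + aeval θ D * hrel
    exact isIntegral_trans (R := ℤ) (A := integralClosure ℤ K) _ hy'
  rw [← hmax, Algebra.adjoin_singleton_eq_range_aeval] at hy
  obtain ⟨Q, hQ⟩ := hy
  have hQ' : aeval θ ((p : ℤ[X]) * Q - ((p : ℤ[X]) * B + π * D)) = 0 := by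
    rw [map_sub, ← hz, map_mul, map_natCast]
    have : aeval θ Q = z / p := hQ
    rw [this]
    field_simp
    ring
  obtain ⟨s, hs⟩ := hdvd _ hQ'
  -- Modulo `p` the relation `π D = -f s = -π ^ 2 D s` makes `π` a unit.
  have hs' := congrArg (map (Int.castRingHom (ZMod p))) hs
  have hf' := congrArg (map (Int.castRingHom (ZMod p))) hf
  have hfm : f.map (Int.castRingHom (ZMod p)) ≠ 0 := (hmonic.map _).ne_zero
  simp only [Polynomial.map_sub, Polynomial.map_add, Polynomial.map_mul, Polynomial.map_pow,
    Polynomial.map_natCast, CharP.cast_eq_zero] at hs' hf'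
  set π' := π.map (Int.castRingHom (ZMod p))
  set D' := D.map (Int.castRingHom (ZMod p))
  set s' := s.map (Int.castRingHom (ZMod p))
  rw [hf'] at hs' hfm
  apply hπ
  have h0 : π' * D' ≠ 0 := by
    rintro h
    apply hfm
    linear_combination π' * h
  refine IsUnit.of_mul_eq_one (-s') (mul_left_cancel₀ h0 ?_)
  linear_combination hs'

/-- An ideal of `ℤ[X]` containing a prime `p` comes from the principal ideal ring `𝔽_p[X]`. -/
lemma exists_span_pair_eq {p : ℕ} [Fact p.Prime] (I : Ideal ℤ[X]) (hp : (p : ℤ[X]) ∈ I) :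
    ∃ π : ℤ[X], I = Ideal.span {(p : ℤ[X]), π} := by
  let r := mapRingHom (Int.castRingHom (ZMod p))
  have hr : Function.Surjective r := map_surjective _ (ZMod.ringHom_surjective _)
  have hker (q : ℤ[X]) (hq : r q = 0) : (p : ℤ[X]) ∣ q :=
    natCast_dvd_of_map_zmod_eq_zero hq
  obtain ⟨π', hπ'⟩ := (IsPrincipalIdealRing.principal (I.map r)).principal
  obtain ⟨π, rfl⟩ := hr π'
  refine ⟨π, le_antisymm (fun q hq ↦ ?_) ?_⟩
  · have h1 : r q ∈ I.map r := Ideal.mem_map_of_mem r hq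
    rw [hπ'] at h1
    obtain ⟨c', hc'⟩ := Ideal.mem_span_singleton.mp h1
    obtain ⟨c, rfl⟩ := hr c'
    obtain ⟨e, he⟩ := hker (q - π * c) (by rw [map_sub, map_mul, hc', sub_self])
    exact Ideal.mem_span_pair.mpr ⟨e, c, by linear_combination -he⟩
  · rw [Ideal.span_le]
    rintro x (rfl | rfl)
    · exact hp
    · have h1 : r x ∈ I.map r := by rw [hπ']; exact Ideal.mem_span_singleton_self _
      obtain ⟨q, hq, hqx⟩ := (Ideal.mem_map_iff_of_surjective r hr).mp h1
      obtain ⟨e, he⟩ := hker (x - q) (by rw [map_sub, hqx, sub_self])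
      have : x = p * e + q := by linear_combination he
      rw [this]
      exact I.add_mem (I.mul_mem_right _ hp) hq

/-- The other half of Dedekind's criterion: `ℤ[X] / (f)` is integrally closed if `f ∉ 𝔪 ^ 2` for
every prime `𝔪` of `ℤ[X]` containing a prime number. Indeed, with `𝔪 = (p, π)` and
`f = a p + b π`, one of `a`, `b` is a unit at `𝔪`, so one of `p`, `π` generates the maximal ideal
of the localization of the quotient, which is then a discrete valuation ring. -/
lemma isIntegrallyClosed_of_notMem_sq {R : Type*} [CommRing R] [IsDomain R]
    [Algebra.IsIntegral ℤ R] (φ : ℤ[X] →+* R) (hφ : Function.Surjective φ) {f : ℤ[X]}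
    (hf : φ f = 0)
    (h : ∀ (p : ℕ) (𝔪 : Ideal ℤ[X]), p.Prime → 𝔪.IsPrime → (p : ℤ[X]) ∈ 𝔪 → f ∉ 𝔪 ^ 2) :
    IsIntegrallyClosed R := by
  have : IsNoetherianRing R := isNoetherianRing_of_surjective _ _ φ hφ
  suffices IsDedekindDomainDvr R from inferInstance
  refine { is_dvr_at_nonzero_prime := fun P hP hPp ↦ ?_ }
  set L := Localization.AtPrime P
  suffices (IsLocalRing.maximalIdeal L).IsPrincipal from
    ((IsDiscreteValuationRing.TFAE L (IsLocalization.AtPrime.not_isField R hP L)).out 4 0).mp this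
  obtain ⟨p, hp, hpP⟩ : ∃ p : ℕ, p.Prime ∧ (p : R) ∈ P := by
    have h1 := Ideal.under_ne_bot ℤ hP
    have h2 : (P.under ℤ).IsPrime := inferInstance
    obtain ⟨a, ha⟩ := (IsPrincipalIdealRing.principal (P.under ℤ)).principal
    have ha' : P.under ℤ = Ideal.span {a} := ha
    have ha0 : a ≠ 0 := by
      rintro rfl
      exact h1 (by simpa using ha')
    rw [ha', Ideal.span_singleton_prime ha0] at h2
    refine ⟨a.natAbs, Int.prime_iff_natAbs_prime.mp h2, ?_⟩
    have h3 : (a.natAbs : ℤ) ∈ P.under ℤ := by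
      rw [ha', Ideal.mem_span_singleton]
      exact Int.dvd_natAbs_self
    simpa only [Ideal.under_def, Ideal.mem_comap, eq_intCast, Int.cast_natCast] using h3
  have : Fact p.Prime := ⟨hp⟩
  have hpm : (p : ℤ[X]) ∈ P.comap φ := by simpa using hpP
  obtain ⟨π, hπ⟩ := exists_span_pair_eq (P.comap φ) hpm
  have hfm : f ∈ P.comap φ := by simp [hf]
  have hP' : P = Ideal.span {(p : R), φ π} := by
    rw [← Ideal.map_comap_of_surjective φ hφ P, hπ, Ideal.map_span, Set.image_pair, map_natCast]
  have hmax : IsLocalRing.maximalIdeal L =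
      Ideal.span {algebraMap R L p, algebraMap R L (φ π)} := by
    rw [← Localization.AtPrime.map_eq_maximalIdeal, ← Set.image_pair, ← Ideal.map_span, ← hP']
  have hunit (a : ℤ[X]) (ha : a ∉ P.comap φ) : IsUnit (algebraMap R L (φ a)) :=
    IsLocalization.map_units L (⟨φ a, ha⟩ : P.primeCompl)
  rw [hπ] at hfm
  obtain ⟨a, b, hab⟩ := Ideal.mem_span_pair.mp hfm
  have hrel : algebraMap R L (φ a) * algebraMap R L p +
      algebraMap R L (φ b) * algebraMap R L (φ π) = 0 := by
    rw [← map_mul, ← map_mul, ← map_add, ← map_natCast φ, ← map_mul, ← map_mul, ← map_add, hab, hf,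
      map_zero]
  have hπm : π ∈ P.comap φ := hπ ▸ Ideal.subset_span (by simp)
  by_cases ha : a ∈ P.comap φ
  · by_cases hb : b ∈ P.comap φ
    · refine absurd ?_ (h p (P.comap φ) hp inferInstance hpm)
      rw [← hab, sq]
      exact add_mem (Ideal.mul_mem_mul ha hpm) (Ideal.mul_mem_mul hb hπm)
    · refine ⟨algebraMap R L p, ?_⟩
      rw [hmax]
      obtain ⟨u, hu⟩ := hunit b hb
      refine le_antisymm (Ideal.span_le.mpr ?_) (Ideal.span_mono (by simp))
      rintro x (rfl | rfl)
      · exact Ideal.mem_span_singleton_self _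
      · refine Ideal.mem_span_singleton.mpr ⟨-(↑u⁻¹ * algebraMap R L (φ a)), ?_⟩
        rw [← hu] at hrel
        linear_combination (↑u⁻¹ : L) * hrel - algebraMap R L (φ π) * u.inv_mul
  · refine ⟨algebraMap R L (φ π), ?_⟩
    rw [hmax]
    obtain ⟨u, hu⟩ := hunit a ha
    refine le_antisymm (Ideal.span_le.mpr ?_) (Ideal.span_mono (by simp))
    rintro x (rfl | rfl)
    · refine Ideal.mem_span_singleton.mpr ⟨-(↑u⁻¹ * algebraMap R L (φ b)), ?_⟩
      rw [← hu] at hrel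
      linear_combination (↑u⁻¹ : L) * hrel - algebraMap R L p * u.inv_mul
    · exact Ideal.mem_span_singleton_self _

lemma adjoin_eq_integralClosure {K : Type*} [Field K] [NumberField K] {θ : K}
    (hgen : IntermediateField.adjoin ℚ {θ} = ⊤) {f : ℤ[X]}
    (hmonic : f.Monic) (hroot : aeval θ f = 0)
    (h : ∀ (p : ℕ) (𝔪 : Ideal ℤ[X]), p.Prime → 𝔪.IsPrime → (p : ℤ[X]) ∈ 𝔪 → f ∉ 𝔪 ^ 2) :
    Algebra.adjoin ℤ {θ} = integralClosure ℤ K := by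
  have hθ : IsIntegral ℤ θ := ⟨f, hmonic, by simpa [aeval_def] using hroot⟩
  set R := Algebra.adjoin ℤ {θ} with hR
  have hle : R ≤ integralClosure ℤ K := adjoin_le_integralClosure hθ
  have : Algebra.IsIntegral ℤ R := ⟨fun x ↦ by
    have : IsIntegral ℤ (x : K) := hle x.2
    exact (isIntegral_algHom_iff R.val Subtype.val_injective).mp this⟩
  let θ' : R := ⟨θ, Algebra.self_mem_adjoin_singleton ℤ θ⟩
  have hval (q : ℤ[X]) : ((aeval θ' q : R) : K) = aeval θ q := by
    have := aeval_algHom_apply R.val θ' q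
    exact this.symm
  have hsurj : Function.Surjective (aeval θ' : ℤ[X] →ₐ[ℤ] R).toRingHom := by
    rintro ⟨x, hx⟩
    rw [hR, Algebra.adjoin_singleton_eq_range_aeval] at hx
    obtain ⟨q, hq⟩ := hx
    exact ⟨q, Subtype.ext ((hval q).trans hq)⟩
  have hic : IsIntegrallyClosed R :=
    isIntegrallyClosed_of_notMem_sq (aeval θ' : ℤ[X] →ₐ[ℤ] R).toRingHom hsurj
      (Subtype.ext ((hval f).trans hroot)) h
  have : IsFractionRing R K := by
    refine IsFractionRing.of_field R K fun z ↦ ?_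
    have hz : z ∈ Algebra.adjoin ℚ {θ} := by
      rw [← IntermediateField.adjoin_simple_toSubalgebra_of_isAlgebraic hθ.tower_top.isAlgebraic,
        hgen]
      trivial
    rw [Algebra.adjoin_singleton_eq_range_aeval] at hz
    obtain ⟨q, rfl⟩ := hz
    obtain ⟨b, hbM, hb⟩ := IsLocalization.integerNormalization_spec (nonZeroDivisors ℤ) q
    have hb0 : (b : K) ≠ 0 := by
      exact_mod_cast nonZeroDivisors.ne_zero hbM
    refine ⟨aeval θ' (IsLocalization.integerNormalization (nonZeroDivisors ℤ) q), b, ?_⟩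
    have h1 := congrArg (aeval θ) hb
    rw [aeval_map_algebraMap] at h1
    have h2 : algebraMap R K (aeval θ'
        (IsLocalization.integerNormalization (nonZeroDivisors ℤ) q)) = b * aeval θ q := by
      refine (hval _).trans (h1.trans ?_)
      rw [Algebra.smul_def]
      simp
    rw [h2, map_intCast]
    exact (mul_div_cancel_left₀ _ hb0).symm
  refine le_antisymm hle fun x hx ↦ ?_
  have hx' : IsIntegral R x := IsIntegral.tower_top (R := ℤ) hx
  obtain ⟨y, rfl⟩ := (IsIntegrallyClosed.isIntegral_iff (R := R) (K := K)).mp hx'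
  exact y.2

/-! ### Regularity of `ℤ[X]` and the polynomials `C_{ℓ ^ n} - t` -/

lemma derivative_mem_of_mem_sq {R : Type*} [CommRing R] {I : Ideal R[X]} {f : R[X]}
    (hf : f ∈ I ^ 2) : derivative f ∈ I := by
  rw [sq] at hf
  induction hf using Submodule.mul_induction_on' with
  | mem_mul_mem a ha b hb =>
    rw [derivative_mul]
    exact add_mem (I.mul_mem_left _ hb) (I.mul_mem_right _ ha)
  | add a _ b _ h1 h2 =>
    rw [derivative_add]
    exact add_mem h1 h2

lemma dvd_of_intCast_mem {p : ℕ} (hp : p.Prime) {𝔪 : Ideal ℤ[X]} (h𝔪 : 𝔪.IsPrime)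
    (hpm : (p : ℤ[X]) ∈ 𝔪) {a : ℤ} (ha : (a : ℤ[X]) ∈ 𝔪) : (p : ℤ) ∣ a := by
  by_contra h
  obtain ⟨u, v, huv⟩ := ((Nat.prime_iff_prime_int.mp hp).coprime_iff_not_dvd).mpr h
  apply h𝔪.ne_top
  rw [Ideal.eq_top_iff_one]
  have h1 : (1 : ℤ[X]) = u * p + v * a := by exact_mod_cast huv.symm
  rw [h1]
  exact add_mem (𝔪.mul_mem_left _ hpm) (𝔪.mul_mem_left _ ha)

/-- As `ℤ[X] / (p)` is regular, `p` is part of a regular system of parameters at every prime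
containing it. -/
lemma natCast_prime_notMem_sq {p : ℕ} (hp : p.Prime) {𝔪 : Ideal ℤ[X]} (h𝔪 : 𝔪.IsPrime)
    (hpm : (p : ℤ[X]) ∈ 𝔪) : (p : ℤ[X]) ∉ 𝔪 ^ 2 := by
  intro h
  have : Fact p.Prime := ⟨hp⟩
  have hp0 : (p : ℤ[X]) ≠ 0 := by exact_mod_cast hp.ne_zero
  have h1m : (1 : ℤ[X]) ∉ 𝔪 := fun h1 ↦ h𝔪.ne_top ((Ideal.eq_top_iff_one _).mpr h1)
  obtain ⟨π, hπ⟩ := exists_span_pair_eq 𝔪 hpm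
  have hπm : π ∈ 𝔪 := hπ ▸ Ideal.subset_span (by simp)
  have hle : 𝔪 ^ 2 ≤ Ideal.span {(p : ℤ[X])} * 𝔪 ⊔ Ideal.span {π ^ 2} := by
    rw [sq, Ideal.mul_le]
    intro r hr s hs
    have hr' := hr
    have hs' := hs
    rw [hπ] at hr' hs'
    obtain ⟨c, e, rfl⟩ := Ideal.mem_span_pair.mp hr'
    obtain ⟨u, v, huv⟩ := Ideal.mem_span_pair.mp hs'
    refine Submodule.mem_sup.mpr ⟨p * (c * s + e * u * π), ?_, π ^ 2 * (e * v), ?_, ?_⟩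
    · exact Ideal.mul_mem_mul (Ideal.mem_span_singleton_self _)
        (add_mem (𝔪.mul_mem_left _ hs) (𝔪.mul_mem_left _ hπm))
    · exact Ideal.mul_mem_right _ _ (Ideal.mem_span_singleton_self _)
    · linear_combination e * π * huv
  obtain ⟨y, hy, z, hz, hyz⟩ := Submodule.mem_sup.mp (hle h)
  obtain ⟨a, ha, rfl⟩ := Ideal.mem_span_singleton_mul.mp hy
  obtain ⟨b, rfl⟩ := Ideal.mem_span_singleton.mp hz
  apply h1m
  have hmod := congrArg (map (Int.castRingHom (ZMod p))) hyz
  simp only [Polynomial.map_add, Polynomial.map_mul, Polynomial.map_pow,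
    Polynomial.map_natCast, CharP.cast_eq_zero, zero_mul, zero_add, mul_eq_zero, ne_eq,
    OfNat.ofNat_ne_zero, not_false_eq_true, pow_eq_zero_iff] at hmod
  rcases hmod with hmod | hmod
  · obtain ⟨c, rfl⟩ := natCast_dvd_of_map_zmod_eq_zero hmod
    have h1 : (1 : ℤ[X]) = a + p * (c ^ 2 * b) :=
      mul_left_cancel₀ hp0 (by linear_combination -hyz)
    rw [h1]
    exact add_mem ha (𝔪.mul_mem_right _ hpm)
  · obtain ⟨c, rfl⟩ := natCast_dvd_of_map_zmod_eq_zero hmod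
    have h1 : (1 : ℤ[X]) = a + π * (π * c) :=
      mul_left_cancel₀ hp0 (by linear_combination -hyz)
    rw [h1]
    exact add_mem ha (𝔪.mul_mem_right _ hπm)

lemma not_squarefree_of_intCast_mem_sq {p : ℕ} (hp : p.Prime) {𝔪 : Ideal ℤ[X]} (h𝔪 : 𝔪.IsPrime)
    (hpm : (p : ℤ[X]) ∈ 𝔪) {a : ℤ} (ha : (a : ℤ[X]) ∈ 𝔪 ^ 2) : ¬ Squarefree a := by
  intro hsq
  obtain ⟨e, rfl⟩ := dvd_of_intCast_mem hp h𝔪 hpm (Ideal.pow_le_self two_ne_zero ha)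
  have hpp := Nat.prime_iff_prime_int.mp hp
  have he : ¬ (p : ℤ) ∣ e := fun h ↦ hpp.not_isUnit (hsq _ (mul_dvd_mul_left _ h))
  obtain ⟨u, v, huv⟩ := (hpp.coprime_iff_not_dvd).mpr he
  apply natCast_prime_notMem_sq hp h𝔪 hpm
  have h1 : (p : ℤ[X]) = u * (p * p) + v * (p * e : ℤ) := by
    have : (p : ℤ) = u * (p * p) + v * (p * e) := by linear_combination -(p : ℤ) * huv
    exact_mod_cast this
  rw [h1]
  refine add_mem (Ideal.mul_mem_left _ _ ?_) (Ideal.mul_mem_left _ _ ha)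
  rw [sq]
  exact Ideal.mul_mem_mul hpm hpm

namespace ChebyshevC

open Chebyshev

/-- If `C_{ℓ ^ (n + 1)} - t` lay in `𝔪 ^ 2`, its derivative `ℓ ^ (n + 1) S_{2m}` would lie in `𝔪`.
Either a square root of `(C - 2) / (X - 2)` or of `(C + 2) / (X + 2)` is then in `𝔪`, forcing
`t - 2` or `t + 2` into `𝔪 ^ 2`, or `ℓ ∈ 𝔪`, and evaluation at `t` gives a multiple of `ℓ ^ 2`. -/
lemma sub_C_notMem_sq {ℓ : ℕ} (hℓ : ℓ.Prime) (hodd : Odd ℓ) (n : ℕ) {t : ℤ}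
    (h1 : ¬ (ℓ : ℤ) ^ 2 ∣ (C ℤ ((ℓ : ℤ) ^ (n + 1))).eval t - t)
    (h2 : Squarefree (t - 2)) (h3 : Squarefree (t + 2))
    {p : ℕ} (hp : p.Prime) {𝔪 : Ideal ℤ[X]} (h𝔪 : 𝔪.IsPrime) (hpm : (p : ℤ[X]) ∈ 𝔪) :
    C ℤ ((ℓ : ℤ) ^ (n + 1)) - Polynomial.C t ∉ 𝔪 ^ 2 := by
  intro hf
  have : Fact ℓ.Prime := ⟨hℓ⟩
  obtain ⟨m, hm⟩ := hodd.pow (n := n + 1)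
  have hm' : (ℓ : ℤ) ^ (n + 1) = 2 * m + 1 := by exact_mod_cast hm
  have hS : S ℤ (2 * m) ∈ 𝔪 → False := by
    intro hS
    have hgh := Ideal.pow_mem_of_mem 𝔪 hS 2 two_pos
    rw [S_two_mul_sq] at hgh
    rcases h𝔪.mem_or_mem (h𝔪.mem_of_pow_mem 2 hgh) with hg | hg
    · refine not_squarefree_of_intCast_mem_sq hp h𝔪 hpm (a := t - 2) ?_ h2
      have := sub_two_eq ℤ m
      rw [hm'] at hf
      have e : ((t - 2 : ℤ) : ℤ[X]) = (X - 2) * (S ℤ m + S ℤ (m - 1)) ^ 2 -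
          (C ℤ (2 * m + 1) - Polynomial.C t) := by
        push_cast
        rw [eq_intCast Polynomial.C t]
        linear_combination this
      rw [e]
      exact sub_mem (Ideal.mul_mem_left _ _ (Ideal.pow_mem_pow hg 2)) hf
    · refine not_squarefree_of_intCast_mem_sq hp h𝔪 hpm (a := t + 2) ?_ h3
      have := add_two_eq ℤ m
      rw [hm'] at hf
      have e : ((t + 2 : ℤ) : ℤ[X]) = (X + 2) * (S ℤ m - S ℤ (m - 1)) ^ 2 -
          (C ℤ (2 * m + 1) - Polynomial.C t) := by
        push_cast
        rw [eq_intCast Polynomial.C t]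
        linear_combination this
      rw [e]
      exact sub_mem (Ideal.mul_mem_left _ _ (Ideal.pow_mem_pow hg 2)) hf
  have hd := derivative_mem_of_mem_sq hf
  have hder := derivative_eq ℤ (2 * m + 1)
  push_cast at hder
  rw [hm', derivative_sub, derivative_C, sub_zero, hder, add_sub_cancel_right] at hd
  rcases h𝔪.mem_or_mem hd with hd | hd
  swap
  · exact hS hd
  -- In the remaining case `ℓ ∈ 𝔪`; then also `X - t ∈ 𝔪`, since `C_{ℓ ^ (n + 1)} - t` is congruent
  -- to `(X - t) ^ ℓ ^ (n + 1)` modulo `ℓ`.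
  have hℓm : (ℓ : ℤ[X]) ∈ 𝔪 := by
    apply h𝔪.mem_of_pow_mem (n + 1)
    convert hd using 1
    exact_mod_cast congrArg (Nat.cast (R := ℤ[X])) hm
  have hXt : X - Polynomial.C t ∈ 𝔪 := by
    apply h𝔪.mem_of_pow_mem (ℓ ^ (n + 1))
    have : (ℓ : ℤ[X]) ∣ (X - Polynomial.C t) ^ ℓ ^ (n + 1) -
        (C ℤ ((ℓ : ℤ) ^ (n + 1)) - Polynomial.C t) :=
      natCast_dvd_X_sub_C_pow_sub ℓ (n + 1) t
    obtain ⟨e, he⟩ := this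
    rw [← sub_add_cancel ((X - Polynomial.C t) ^ ℓ ^ (n + 1))
      (C ℤ ((ℓ : ℤ) ^ (n + 1)) - Polynomial.C t), he]
    exact add_mem (𝔪.mul_mem_right _ hℓm) (Ideal.pow_le_self two_ne_zero hf)
  have hle : 𝔪.map (evalRingHom t) ≤ Ideal.span {(ℓ : ℤ)} := by
    rw [Ideal.map_le_iff_le_comap]
    intro q hq
    rw [Ideal.mem_comap, Ideal.mem_span_singleton]
    apply dvd_of_intCast_mem hℓ h𝔪 hℓm
    obtain ⟨r, hr⟩ := X_sub_C_dvd_sub_C_eval (a := t) (p := q)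
    have e : ((evalRingHom t q : ℤ) : ℤ[X]) = q - (X - Polynomial.C t) * r := by
      rw [← hr, ← eq_intCast Polynomial.C]
      simp
    rw [e]
    exact sub_mem hq (𝔪.mul_mem_right _ hXt)
  have h4 := Ideal.mem_map_of_mem (evalRingHom t) hf
  rw [Ideal.map_pow] at h4
  have h5 := Ideal.pow_right_mono hle 2 h4
  rw [Ideal.span_singleton_pow, Ideal.mem_span_singleton] at h5
  exact h1 (by simpa using h5)

lemma not_isUnit_of_mul_sq_eq {F : Type*} [Field F] {d : ℕ} (hd : 1 < d) {a b : F} {g : F[X]}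
    (h : C F d - Polynomial.C a = (X - Polynomial.C b) * g ^ 2) : ¬ IsUnit g := by
  intro hg
  have h1 := congrArg Polynomial.natDegree h
  rw [natDegree_sub_C, natDegree, natDegree_mul (X_sub_C_ne_zero b) (pow_ne_zero _ hg.ne_zero),
    natDegree_X_sub_C, natDegree_pow, natDegree_eq_zero_of_isUnit hg] at h1
  omega

end ChebyshevC

/-- Applied to `a = 2` and `a = -2`: if `p ^ 2 ∣ t - a` then `f = (X - a) g ^ 2 - (t - a)` lies in
`(p, g) ^ 2`. -/
lemma adjoin_ne_integralClosure_of_not_squarefree {K : Type*} [Field K] [CharZero K] {θ : K}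
    {f : ℤ[X]} (hmonic : f.Monic) (hroot : aeval θ f = 0)
    (hdvd : ∀ q : ℤ[X], aeval θ q = 0 → f ∣ q)
    {d : ℕ} (hd : 1 < d) {t a : ℤ} {g : ℤ[X]} (hf : f = Chebyshev.C ℤ d - C t)
    (hg : Chebyshev.C ℤ d - C a = (X - C a) * g ^ 2)
    (h : ¬ Squarefree (t - a)) : Algebra.adjoin ℤ {θ} ≠ integralClosure ℤ K := by
  rw [← Int.squarefree_natAbs, Nat.squarefree_iff_prime_squarefree] at h
  push Not at h
  obtain ⟨p, hp, hpa⟩ := h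
  have : Fact p.Prime := ⟨hp⟩
  obtain ⟨c, hc⟩ : (p : ℤ) * p ∣ t - a := by
    rw [← Int.dvd_natAbs]
    exact_mod_cast hpa
  refine not_adjoin_eq_integralClosure hmonic hroot hdvd hp (π := g) (A := -C c) (B := 0)
    (D := X - C a) ?_ ?_
  · have h1 := congrArg (map (Int.castRingHom (ZMod p))) hg
    simp only [Polynomial.map_sub, Polynomial.map_mul, Polynomial.map_pow, map_X, Polynomial.map_C,
      Chebyshev.map_C] at h1
    exact ChebyshevC.not_isUnit_of_mul_sq_eq hd h1
  · have h2 := congrArg (C : ℤ → ℤ[X]) hc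
    simp only [map_sub, map_mul, map_natCast] at h2
    rw [hf]
    linear_combination hg - h2

/-- Modulo `ℓ` the polynomial `f` is `(X - t) ^ ℓ ^ (n + 1)`, so `ℓ ^ 2 ∣ f(t)` puts `f` in
`(ℓ, X - t) ^ 2`. -/
lemma adjoin_ne_integralClosure_of_sq_dvd_eval {K : Type*} [Field K] [CharZero K] {θ : K}
    {f : ℤ[X]} (hmonic : f.Monic) (hroot : aeval θ f = 0)
    (hdvd : ∀ q : ℤ[X], aeval θ q = 0 → f ∣ q) {ℓ : ℕ} (hℓ : ℓ.Prime) {n : ℕ} {t : ℤ}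
    (hf : f = Chebyshev.C ℤ ((ℓ : ℤ) ^ (n + 1)) - C t) (h : (ℓ : ℤ) ^ 2 ∣ f.eval t) :
    Algebra.adjoin ℤ {θ} ≠ integralClosure ℤ K := by
  have : Fact ℓ.Prime := ⟨hℓ⟩
  obtain ⟨e, he⟩ := ChebyshevC.natCast_dvd_X_sub_C_pow_sub ℓ (n + 1) t
  rw [← hf] at he
  obtain ⟨c, hc⟩ := h
  have hq : 2 ≤ ℓ ^ (n + 1) := hℓ.two_le.trans (Nat.le_self_pow n.succ_ne_zero ℓ)
  obtain ⟨k, hk⟩ := Nat.exists_eq_add_of_le hq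
  have hℓ0 : (ℓ : ℤ) ≠ 0 := by exact_mod_cast hℓ.ne_zero
  have het : e.eval t = -(ℓ * c) := by
    have h1 := congrArg (eval t) he
    simp only [eval_sub, eval_pow, eval_X, eval_C, sub_self, eval_mul, eval_natCast, hc,
      zero_pow (show ℓ ^ (n + 1) ≠ 0 by omega)] at h1
    exact mul_left_cancel₀ hℓ0 (by linear_combination -h1)
  obtain ⟨r, hr⟩ := X_sub_C_dvd_sub_C_eval (a := t) (p := e)
  rw [het] at hr
  simp only [map_neg, map_mul, map_natCast] at hr
  refine not_adjoin_eq_integralClosure hmonic hroot hdvd hℓ (π := X - C t) (A := C c) (B := -r)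
    (D := (X - C t) ^ k) ?_ ?_
  · rw [Polynomial.map_sub, map_X, Polynomial.map_C]
    exact not_isUnit_X_sub_C _
  · rw [hk, pow_add] at he
    linear_combination -he - (ℓ : ℤ[X]) * hr

/-! ### Discriminants -/

/-- Both sides are, up to the same sign, the norm of `f'(θ)`, which is the resultant of `f` and
`f'`. -/
lemma Algebra.discr_powerBasis_eq_discr {R K L : Type*} [CommRing R] [Nontrivial R] [Field K]
    [Field L] [Algebra R K] [Algebra K L] [FiniteDimensional K L] [Algebra.IsSeparable K L]
    (pb : PowerBasis K L) {f : R[X]} (hf : f.Monic)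
    (hmin : f.map (algebraMap R K) = minpoly K pb.gen) :
    Algebra.discr K pb.basis = algebraMap R K f.discr := by
  have hnat : f.natDegree = Module.finrank K L := by
    rw [pb.finrank, ← pb.natDegree_minpoly, ← hmin, hf.natDegree_map]
  have hpos : 0 < f.degree := by
    rw [← natDegree_pos_iff_degree_pos, hnat]
    exact Module.finrank_pos
  let E := AlgebraicClosure L
  have hnorm : Algebra.norm K (aeval pb.gen (minpoly K pb.gen).derivative) =
      algebraMap R K (resultant f (derivative f) f.natDegree (f.natDegree - 1)) := by
    apply (algebraMap K E).injective
    rw [← resultant_map_map, ← resultant_map_map, hmin, ← derivative_map, hmin,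
      Algebra.norm_eq_prod_embeddings]
    set g := (minpoly K pb.gen).map (algebraMap K E) with hg
    have hgdeg : f.natDegree = g.natDegree := by
      rw [hg, natDegree_map, ← hmin, hf.natDegree_map]
    have hgm : g.Monic := (minpoly.monic pb.isIntegral_gen).map _
    rw [hgdeg, resultant_eq_prod_eval _ _ _
      ((natDegree_map_le).trans (natDegree_derivative_le _ |>.trans (by rw [hg, natDegree_map])))
      (IsAlgClosed.splits _), hgm.leadingCoeff, one_pow, one_mul]
    have hsep : g.Separable := Polynomial.Separable.map (Algebra.IsSeparable.isSeparable K pb.gen)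
    have hnodup := nodup_roots hsep
    classical
    have hprod : (g.roots.map fun x ↦ eval x ((derivative (minpoly K pb.gen)).map
        (algebraMap K E))).prod = ∏ x : {y : E // y ∈ g.roots},
          eval (x : E) ((derivative (minpoly K pb.gen)).map (algebraMap K E)) := by
      rw [Finset.prod_mem_multiset _ _ (fun x ↦ eval x
        ((derivative (minpoly K pb.gen)).map (algebraMap K E))) (fun _ ↦ rfl),
        Finset.prod_eq_multiset_prod, Multiset.toFinset_val, Multiset.dedup_eq_self.mpr hnodup]
    rw [hprod]
    refine Fintype.prod_equiv pb.liftEquiv' _ _ fun σ ↦ ?_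
    rw [PowerBasis.liftEquiv'_apply_coe, eval_map_algebraMap, aeval_algHom_apply]
  rw [Algebra.discr_powerBasis_eq_norm, hnorm, resultant_deriv hpos, hf.leadingCoeff, hnat,
    pb.finrank]
  simp only [map_mul, map_pow, map_neg, map_one, mul_one]
  rw [← mul_assoc, ← mul_pow]
  simp

lemma minpoly_eq_of_irreducible {K : Type*} [Field K] [CharZero K] {θ : K} {f : ℤ[X]}
    (hmonic : f.Monic) (hirr : Irreducible f) (hroot : aeval θ f = 0) : minpoly ℤ θ = f := by
  have hθ : IsIntegral ℤ θ := ⟨f, hmonic, by simpa [aeval_def] using hroot⟩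
  have h1 := minpoly.isIntegrallyClosed_dvd hθ hroot
  have h2 : Associated (minpoly ℤ θ) f :=
    (minpoly.irreducible hθ).associated_of_dvd hirr h1
  exact eq_of_monic_of_associated (minpoly.monic hθ) hmonic h2

open scoped Matrix in
/-- Writing the powers of `θ` in an integral basis of `K` gives an integer matrix `M` with
`disc f = (det M) ^ 2 * disc K`, so the discriminants agree exactly when `M` is invertible
over `ℤ`. -/
lemma discr_eq_iff {K : Type*} [Field K] [NumberField K] {θ : K} {f : ℤ[X]}
    (hmonic : f.Monic) (hirr : Irreducible f) (h : IsGeneratedByRoot f K θ) :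
    f.discr = NumberField.discr K ↔ IsMaximalOrderGenerator K θ := by
  classical
  have hθ : IsIntegral ℤ θ := ⟨f, hmonic, by simpa [aeval_def] using h.root⟩
  have hminZ : minpoly ℤ θ = f := minpoly_eq_of_irreducible hmonic hirr h.root
  have hminQ : minpoly ℚ θ = (minpoly ℤ θ).map (algebraMap ℤ ℚ) :=
    minpoly.isIntegrallyClosed_eq_field_fractions' ℚ hθ
  have htop : Algebra.adjoin ℚ {θ} = ⊤ :=
    Algebra.adjoin_eq_top_of_primitive_element hθ.tower_top.isAlgebraic h.gen
  set pb : PowerBasis ℚ K := PowerBasis.ofAdjoinEqTop hθ.tower_top htop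
  have hgen : pb.gen = θ := PowerBasis.ofAdjoinEqTop_gen _ _
  have hdiscr : Algebra.discr ℚ pb.basis = f.discr := by
    simpa using Algebra.discr_powerBasis_eq_discr pb hmonic (by rw [hgen, hminQ, hminZ])
  obtain ⟨θ', hθ'⟩ := (IsIntegralClosure.isIntegral_iff (A := 𝓞 K)).mp hθ
  constructor
  · intro heq
    set b : Module.Basis (Fin pb.dim) ℚ K :=
      (integralBasis K).reindex ((integralBasis K).indexEquiv pb.basis) with hb
    have hbdiscr : Algebra.discr ℚ b = NumberField.discr K := by
      rw [hb, Module.Basis.coe_reindex, Algebra.discr_reindex, NumberField.coe_discr]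
    -- The integer matrix expressing the powers of `θ` in an integral basis.
    have hM : ∃ M : Matrix (Fin pb.dim) (Fin pb.dim) ℤ,
        M.map (algebraMap ℤ ℚ) = b.toMatrix pb.basis := by
      refine ⟨Matrix.of fun i j ↦ (RingOfIntegers.basis K).repr (θ' ^ (j : ℕ))
        (((integralBasis K).indexEquiv pb.basis).symm i), ?_⟩
      ext i j
      rw [Matrix.map_apply, Matrix.of_apply, ← integralBasis_repr_apply, Module.Basis.toMatrix_apply,
        pb.basis_eq_pow, hgen, hb, Module.Basis.repr_reindex_apply, map_pow, hθ']
    obtain ⟨M, hM⟩ := hM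
    have hdet : (M.det : ℚ) ^ 2 = 1 := by
      have h1 := Algebra.discr_of_matrix_vecMul (A := ℚ) b (b.toMatrix pb.basis)
      rw [Module.Basis.toMatrix_map_vecMul, hdiscr, hbdiscr, heq, ← hM] at h1
      have h2 : (M.map (algebraMap ℤ ℚ)).det = M.det := (RingHom.map_det _ _).symm
      rw [h2] at h1
      have h3 : (NumberField.discr K : ℚ) ≠ 0 := by exact_mod_cast NumberField.discr_ne_zero K
      exact mul_right_cancel₀ h3 (by rw [← h1, one_mul])
    have hunit : IsUnit M.det := by
      rw [Int.isUnit_iff, ← sq_eq_one_iff]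
      exact_mod_cast hdet
    have hMN : M * M⁻¹ = 1 := Matrix.mul_nonsing_inv M hunit
    have hbv : (b : Fin pb.dim → K) =
        (pb.basis : Fin pb.dim → K) ᵥ* (M⁻¹).map (algebraMap ℤ K) := by
      have h1 : (b : Fin pb.dim → K) ᵥ* M.map (algebraMap ℤ K) = pb.basis := by
        rw [← Module.Basis.toMatrix_map_vecMul b pb.basis, ← hM, Matrix.map_map]
        congr 2
        ext k
        simp
      rw [← h1, Matrix.vecMul_vecMul, ← Matrix.map_mul, hMN]
      simp
    refine le_antisymm (adjoin_le_integralClosure hθ) fun x hx ↦ ?_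
    have hx' : x ∈ Submodule.span ℤ (Set.range (integralBasis K)) :=
      (mem_span_integralBasis K).mpr ⟨⟨x, hx⟩, rfl⟩
    refine (Submodule.span_le (p := Subalgebra.toSubmodule (Algebra.adjoin ℤ {θ}))).mpr ?_ hx'
    rintro _ ⟨i, rfl⟩
    have hi : integralBasis K i = b ((integralBasis K).indexEquiv pb.basis i) := by simp [hb]
    rw [hi, hbv]
    change ∑ j, pb.basis j * algebraMap ℤ K (M⁻¹ j _) ∈ Algebra.adjoin ℤ {θ}
    refine Subalgebra.sum_mem _ fun j _ ↦ Subalgebra.mul_mem _ ?_ (Subalgebra.algebraMap_mem _ _)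
    rw [pb.basis_eq_pow, hgen]
    exact Subalgebra.pow_mem _ (Algebra.self_mem_adjoin_singleton ℤ θ) _
  · intro hmax
    have h1 : Algebra.discr ℚ pb.basis = Algebra.discr ℚ (integralBasis K) := by
      apply Algebra.discr_eq_discr_of_toMatrix_coeff_isIntegral
      · intro i j
        rw [Module.Basis.toMatrix_apply]
        have hj : integralBasis K j ∈ Algebra.adjoin ℤ {θ} := by
          rw [hmax, integralBasis_apply]
          exact ((RingOfIntegers.basis K) j).2
        rw [Algebra.adjoin_singleton_eq_range_aeval] at hj
        obtain ⟨q, hq⟩ := hj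
        rw [← hq]
        change IsIntegral ℤ (pb.basis.repr (aeval θ q) i)
        rw [aeval_eq_sum_range, map_sum, Finsupp.finsetSum_apply]
        refine IsIntegral.sum _ fun k _ ↦ ?_
        rw [← Int.cast_smul_eq_zsmul ℚ, map_smul, Finsupp.smul_apply, smul_eq_mul, ← hgen]
        refine IsIntegral.mul (by simpa using isIntegral_algebraMap (R := ℤ) (A := ℚ)) ?_
        exact PowerBasis.repr_gen_pow_isIntegral (by rw [hgen]; exact hθ)
          (by rw [hgen, hminQ]) k i
      · intro i j
        rw [Module.Basis.toMatrix_apply, pb.basis_eq_pow, hgen]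
        have := integralBasis_repr_apply K (θ' ^ (j : ℕ)) i
        rw [map_pow, hθ'] at this
        refine this ▸ isIntegral_algebraMap
    rw [hdiscr, ← NumberField.coe_discr] at h1
    exact_mod_cast h1

lemma IsMaximalOrderGenerator.isMonogenicField {K : Type*} [Field K] [NumberField K] {θ : K}
    (hθ : IsIntegral ℤ θ)
    (h : IsMaximalOrderGenerator K θ) : IsMonogenicField K := by
  obtain ⟨θ', rfl⟩ := (IsIntegralClosure.isIntegral_iff (A := 𝓞 K)).mp hθ
  refine ⟨PowerBasis.ofAdjoinEqTop' (x := θ') (Algebra.IsIntegral.isIntegral _) ?_⟩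
  rw [eq_top_iff]
  rintro x -
  have hx : algebraMap (𝓞 K) K x ∈ Algebra.adjoin ℤ {algebraMap (𝓞 K) K θ'} := by
    rw [h]
    exact x.2
  rw [Algebra.adjoin_singleton_eq_range_aeval] at hx ⊢
  obtain ⟨q, hq⟩ := hx
  exact ⟨q, RingOfIntegers.ext ((aeval_algebraMap_apply K θ' q).symm.trans hq)⟩

/-! ### The criterion -/

lemma isMaximalOrderGenerator_iff {ℓ : ℕ} (hℓ : ℓ.Prime) (hodd : Odd ℓ) {t : ℤ} {n : ℕ}
    (hn : 1 ≤ n) (hirr : Irreducible (chebPhi ℓ n t)) {K : Type*} [Field K] [NumberField K] {θ : K}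
    (h : IsGeneratedByRoot (chebPhi ℓ n t) K θ) :
    IsMaximalOrderGenerator K θ ↔
      (¬ (chebT ℓ).eval t ≡ t [ZMOD (ℓ : ℤ) ^ 2]) ∧ Squarefree (t - 2) ∧ Squarefree (t + 2) := by
  have : Fact ℓ.Prime := ⟨hℓ⟩
  obtain ⟨n, rfl⟩ := Nat.exists_eq_succ_of_ne_zero (Nat.one_le_iff_ne_zero.mp hn)
  have hΦ : chebPhi ℓ (n + 1) t = Chebyshev.C ℤ ((ℓ : ℤ) ^ (n + 1)) - C t := by
    rw [chebPhi, polyIter_chebT]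
  have hmonic := monic_chebPhi hℓ (n + 1) t
  have hdvd (q : ℤ[X]) (hq : aeval θ q = 0) : chebPhi ℓ (n + 1) t ∣ q := by
    have hθ : IsIntegral ℤ θ := ⟨_, hmonic, by simpa [aeval_def] using h.root⟩
    rw [← minpoly_eq_of_irreducible hmonic hirr h.root]
    exact minpoly.isIntegrallyClosed_dvd hθ hq
  have hmod : (chebT ℓ).eval t ≡ t [ZMOD (ℓ : ℤ) ^ 2] ↔
      (ℓ : ℤ) ^ 2 ∣ (chebPhi ℓ (n + 1) t).eval t := by
    rw [Int.modEq_iff_dvd, dvd_sub_comm, hΦ, eval_sub, eval_C, chebT]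
    have := ChebyshevC.sq_dvd_eval_sub_eval ℓ n t
    rw [← dvd_add_right this]
    ring_nf
  rw [hmod]
  have hd : 1 < ℓ ^ (n + 1) := Nat.one_lt_pow n.succ_ne_zero hℓ.one_lt
  obtain ⟨m, hm⟩ := hodd.pow (n := n + 1)
  have hm' : ((ℓ ^ (n + 1) : ℕ) : ℤ) = 2 * m + 1 := by exact_mod_cast hm
  constructor
  · intro hmax
    refine ⟨fun h1 ↦ ?_, ?_, ?_⟩
    · exact adjoin_ne_integralClosure_of_sq_dvd_eval hmonic h.root hdvd hℓ hΦ h1 hmax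
    · by_contra h1
      refine adjoin_ne_integralClosure_of_not_squarefree hmonic h.root hdvd hd (t := t) (a := 2)
        (g := Chebyshev.S ℤ m + Chebyshev.S ℤ (m - 1)) (by rw [hΦ]; push_cast; rfl) ?_ h1 hmax
      rw [hm']
      exact ChebyshevC.sub_two_eq ℤ m
    · by_contra h1
      refine adjoin_ne_integralClosure_of_not_squarefree hmonic h.root hdvd hd (t := t) (a := -2)
        (g := Chebyshev.S ℤ m - Chebyshev.S ℤ (m - 1)) (by rw [hΦ]; push_cast; rfl) ?_
        (by rwa [sub_neg_eq_add]) hmax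
      rw [hm', C_neg, sub_neg_eq_add, sub_neg_eq_add]
      exact ChebyshevC.add_two_eq ℤ m
  · rintro ⟨h1, h2, h3⟩
    refine adjoin_eq_integralClosure h.gen hmonic h.root fun p 𝔪 hp h𝔪 hpm ↦ ?_
    rw [hΦ] at h1 ⊢
    rw [eval_sub, eval_C] at h1
    exact ChebyshevC.sub_C_notMem_sq hℓ hodd n h1 h2 h3 hp h𝔪 hpm

theorem theorem3p5 (ℓ : ℕ) (hℓ : ℓ.Prime) (hodd : Odd ℓ) (t : ℤ) :
    (∀ n : ℕ, 1 ≤ n → Irreducible (chebPhi ℓ n t) →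
      ∀ (K : Type*) [Field K] [NumberField K] (θ : K),
        IsGeneratedByRoot (chebPhi ℓ n t) K θ →
          ((chebPhi ℓ n t).discr = NumberField.discr K ↔
            (¬ (chebT ℓ).eval t ≡ t [ZMOD (ℓ : ℤ) ^ 2]) ∧
              Squarefree (t - 2) ∧ Squarefree (t + 2)) ∧
          ((chebPhi ℓ n t).discr = NumberField.discr K ↔ IsMaximalOrderGenerator K θ) ∧
          ((chebPhi ℓ n t).discr = NumberField.discr K → IsMonogenicField K)) ∧
    (∀ m n : ℕ, 1 ≤ m → 1 ≤ n →
      Irreducible (chebPhi ℓ m t) → Irreducible (chebPhi ℓ n t) →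
      ∀ (K : Type*) [Field K] [NumberField K] (θ : K)
        (L : Type*) [Field L] [NumberField L] (η : L),
        IsGeneratedByRoot (chebPhi ℓ m t) K θ → IsGeneratedByRoot (chebPhi ℓ n t) L η →
          (IsMaximalOrderGenerator K θ ↔ IsMaximalOrderGenerator L η)) := by
  refine ⟨fun n hn hirr K _ _ θ h ↦ ?_, fun m n hm hn hm' hn' K _ _ θ L _ _ η h h' ↦ ?_⟩
  · have hmonic := monic_chebPhi hℓ n t
    have hdisc := discr_eq_iff hmonic hirr h
    have hθ : IsIntegral ℤ θ := ⟨_, hmonic, by simpa [aeval_def] using h.root⟩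
    exact ⟨hdisc.trans (isMaximalOrderGenerator_iff hℓ hodd hn hirr h), hdisc,
      fun heq ↦ (hdisc.mp heq).isMonogenicField hθ⟩
  · rw [isMaximalOrderGenerator_iff hℓ hodd hm hm' h, isMaximalOrderGenerator_iff hℓ hodd hn hn' h']
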